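/- All groups are finite. A Frobenius complement in a group $X$ is a subgroup $1 < A < X$ with $A \cap A^{x} = 1$ for all $x \in X \setminus A$; a group $X$ that has such a subgroup $A$ is a Frobenius group, and the set $\left(X \setminus \bigcup_{x \in X} A^{x}\right) \cup \{1\}$ is its Frobenius kernel. Let $G$ be a $2$-Frobenius group, that is, $G$ has normal subgroups $K \le L$ such that $L$ is a Frobenius group with Frobenius kernel $K$ and $G/K$ is a Frobenius group with Frobenius kernel $L/K$. Let $p$ be a prime. Let $\Delta(G)$ be the cyclic graph of $G$: its vertices are the nonidentity elements of $G$, and distinct vertices $x$ and $y$ are adjacent if and only if $\langle x, y\rangle$ is cyclic. Let $m_p(G)$ be the number of subgroups of order $p$ of $G$. (i) If $K \le D \le G$ and $D/K$ is a Frobenius complement of the Frobenius group $G/K$ with Frobenius kernel $L/K$, then $D$ is a $p$-group if and only if $K$ and $G/L$ are $p$-groups. (ii) If $K$ and $G/L$ are $p$-groups (equivalently, if such a $D$ is a $p$-group), then $\Delta(G)$ has exactly $|K| + m_p(G)$ connected components. -/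

import Mathlib

/-- `H` is a Frobenius complement in the (finite) group `G`: a nontrivial proper subgroup that meets
each of its conjugates `gHg⁻¹` with `g ∉ H` trivially. -/
def IsFrobeniusComplement {G : Type*} [Group G] (H : Subgroup G) : Prop :=
  H ≠ ⊥ ∧ H ≠ ⊤ ∧ ∀ g : G, g ∉ H → ∀ x ∈ H, g * x * g⁻¹ ∈ H → x = 1

/-- `G` is a Frobenius group with Frobenius complement `H` and Frobenius kernel `K`: the subgroup `K`
consists of the identity and of the elements that lie in no conjugate of `H`. -/
def IsFrobeniusWith {G : Type*} [Group G] (H K : Subgroup G) : Prop :=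
  IsFrobeniusComplement H ∧ ∀ x : G, x ∈ K ↔ (x = 1 ∨ ∀ g : G, g * x * g⁻¹ ∉ H)

/-- `G` is a Frobenius group with Frobenius kernel `K`. -/
def IsFrobeniusKernel {G : Type*} [Group G] (K : Subgroup G) : Prop :=
  ∃ H : Subgroup G, IsFrobeniusWith H K

/-- `G` is a `2`-Frobenius group, witnessed by the normal subgroups `K` and `L`: the group `L` is a
Frobenius group with Frobenius kernel `K`, and `G ⧸ K` is a Frobenius group with Frobenius kernel
`L/K`. -/
structure IsTwoFrobenius {G : Type*} [Group G] (K L : Subgroup G) [K.Normal] [L.Normal] : Prop where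
  le : K ≤ L
  lower : IsFrobeniusKernel (K.subgroupOf L)
  upper : IsFrobeniusKernel (L.map (QuotientGroup.mk' K))

/-- The cyclic graph `Δ(G)`: the vertices are the nonidentity elements of `G`, and distinct vertices
`x` and `y` are adjacent if and only if the subgroup `⟨x, y⟩` is cyclic. -/
def cyclicGraph (G : Type*) [Group G] : SimpleGraph {x : G // x ≠ 1} where
  Adj x y := x ≠ y ∧ IsCyclic (Subgroup.closure {(x : G), (y : G)})
  symm := ⟨fun x y h => ⟨h.1.symm, by rw [Set.pair_comm]; exact h.2⟩⟩
  loopless := ⟨fun _ h => h.1 rfl⟩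

/-- The number `m_p(G)` of subgroups of order `p` of `G`. -/
noncomputable def numSubgroupsOfOrder (p : ℕ) (G : Type*) [Group G] : ℕ :=
  Nat.card {P : Subgroup G // Nat.card P = p}

/-!
Part (i) holds because `G = L D` and `L ∩ D = K`, so that `D ⧸ K ≅ G ⧸ L`. That the kernel and a
complement of a Frobenius group factorize it is a count of the elements lying in conjugates of the
complement (`IsFrobeniusWith.card_mul_card`).

For part (ii), let `H` be a Frobenius complement of `L`. An element of `G` outside `L` is a
`p`-element, as its image in `G ⧸ K` lies in a complement isomorphic to `G ⧸ L` and `K` is a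
`p`-group; an element of
`L \ K` lies in exactly one of the `|K|` conjugates of `H` in `L`, which contain no `p`-element
but `1`. Hence every nontrivial cyclic subgroup of `G` meets exactly one of the following subgroups
nontrivially: the subgroups of order `p` and the conjugates of `H`. If all of these are cyclic, they
label the connected components of the cyclic graph (`card_connectedComponent_cyclicGraph`).

It remains to see that `H` is cyclic (`IsTwoFrobenius.isCyclic_complement`), and two facts give
this. Since `H` acts fixed-point-freely on the centre of the `p`-group `K`, a norm argument
(`pow_eq_one_of_fixedPointFree_action`) shows that elementary abelian subgroups of `H` are cyclic.
Since `H ≅ L ⧸ K` is the kernel of the Frobenius group `G ⧸ K`, it has a fixed-point-free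
automorphism `σ`. Every element is then of the form `x / σ x`, so each cyclic normal `σ`-invariant
subgroup is central (`MonoidHom.FixedPointFree.le_center_of_isCyclic`). Applied inside a
`σ`-invariant Sylow subgroup this shows that the Sylow subgroups are cyclic; then the commutator
subgroup is cyclic, hence central, and `H` is a nilpotent group with cyclic Sylow subgroups. This
avoids both Thompson's theorem on Frobenius kernels and the structure theory of complements.
-/

/-! ### Groups whose elementary abelian subgroups are cyclic -/

/-- Every elementary abelian subgroup is cyclic, expressed by elements: of two commuting elements
`x` and `z ≠ 1` with `x ^ q = z ^ q = 1`, `q` prime, the first is a power of the second. -/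
def ElementaryAbelianCyclic (G : Type*) [Group G] : Prop :=
  ∀ q : ℕ, q.Prime → ∀ x z : G, Commute x z → x ^ q = 1 → z ^ q = 1 → z ≠ 1 →
    x ∈ Subgroup.zpowers z

theorem ElementaryAbelianCyclic.of_injective {G H : Type*} [Group G] [Group H]
    (hH : ElementaryAbelianCyclic H) (f : G →* H) (hf : Function.Injective f) :
    ElementaryAbelianCyclic G := by
  intro q hq x z hc hx hz hz1
  obtain ⟨k, hk⟩ := hH q hq (f x) (f z) (hc.map f) (by rw [← map_pow, hx, map_one])
    (by rw [← map_pow, hz, map_one]) (by rwa [ne_eq, map_eq_one_iff f hf])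
  exact ⟨k, hf (by simpa using hk)⟩

theorem ElementaryAbelianCyclic.subgroup {G : Type*} [Group G] (hG : ElementaryAbelianCyclic G)
    (H : Subgroup G) : ElementaryAbelianCyclic H :=
  hG.of_injective H.subtype H.subtype_injective

/-- With `Finset` cardinalities in place of kernels, this is the bound on `n`-torsion that
`isCyclic_of_card_pow_eq_one_le` asks for. -/
theorem ElementaryAbelianCyclic.card_powMonoidHom_ker_le {G : Type*} [CommGroup G] [Finite G]
    (hG : ElementaryAbelianCyclic G) {n : ℕ} (hn : n ≠ 0) :
    Nat.card (powMonoidHom n : G →* G).ker ≤ n := by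
  induction n using induction_on_primes with
  | zero => exact absurd rfl hn
  | one =>
    have h : (powMonoidHom 1 : G →* G).ker = ⊥ :=
      (Subgroup.eq_bot_iff_forall _).mpr fun x hx => by simpa [MonoidHom.mem_ker] using hx
    rw [h, Subgroup.card_bot]
  | prime_mul q n hq ih =>
    have hn' : n ≠ 0 := right_ne_zero_of_mul hn
    -- `x ↦ x ^ q` maps the `q * n`-torsion to the `n`-torsion
    let f : (powMonoidHom (q * n) : G →* G).ker →* (powMonoidHom n : G →* G).ker :=
      ((powMonoidHom q).comp (Subgroup.subtype _)).codRestrict _ (fun x => by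
        have hx : (x : G) ^ (q * n) = 1 := x.2
        change ((x : G) ^ q) ^ n = 1
        rw [← pow_mul, hx])
    have hf : ∀ x ∈ f.ker, (x : G) ^ q = 1 := fun x hx => congrArg Subtype.val hx
    have hker : Nat.card f.ker ≤ q := by
      by_cases hbot : f.ker = ⊥
      · rw [hbot, Subgroup.card_bot]
        exact hq.one_lt.le
      · obtain ⟨z, hz, hz1⟩ := f.ker.bot_or_exists_ne_one.resolve_left hbot
        have hle : f.ker ≤ Subgroup.zpowers z := fun x hx =>
          (hG.subgroup _) q hq x z (Commute.all _ _) (Subtype.ext (hf x hx))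
            (Subtype.ext (hf _ hz)) hz1
        calc Nat.card f.ker ≤ Nat.card (Subgroup.zpowers z) := Subgroup.card_le_of_le hle
          _ = orderOf z := Nat.card_zpowers _
          _ ≤ q := Nat.le_of_dvd hq.pos (orderOf_dvd_of_pow_eq_one (Subtype.ext (hf _ hz)))
    calc Nat.card (powMonoidHom (q * n) : G →* G).ker
        = Nat.card f.ker * Nat.card f.range := by
          rw [← Subgroup.card_mul_index f.ker, Subgroup.index_ker]
      _ ≤ q * n := Nat.mul_le_mul hker
          ((Nat.card_le_card_of_injective _ Subtype.val_injective).trans (ih hn'))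

theorem ElementaryAbelianCyclic.isCyclic_of_comm {G : Type*} [Group G] [Finite G]
    (hG : ElementaryAbelianCyclic G) (hcomm : ∀ a b : G, a * b = b * a) : IsCyclic G := by
  let _ : CommGroup G := { ‹Group G› with mul_comm := hcomm }
  classical
  have := Fintype.ofFinite G
  refine isCyclic_of_card_pow_eq_one_le fun n hn => ?_
  rw [← Fintype.card_subtype, ← Nat.card_eq_fintype_card]
  exact hG.card_powMonoidHom_ker_le hn.ne'

/-! ### Fixed-point-free automorphisms -/

/-- Conjugation gives a homomorphism `c` from `G` to the abelian group `Aut M`, and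
`c (σ x) = σ c(x) σ⁻¹ = c x`; so `c` kills all `x / σ x`, that is, all of `G`. -/
theorem MonoidHom.FixedPointFree.le_center_of_isCyclic {G : Type*} [Group G] [Finite G]
    {σ : G ≃* G} (hσ : MonoidHom.FixedPointFree σ) (M : Subgroup G) [M.Normal] [IsCyclic M]
    (hM : ∀ x ∈ M, σ x ∈ M) : M ≤ Subgroup.center G := by
  have hpow : ∀ f : M →* M, ∃ k : ℤ, ∀ m, f m = m ^ k := fun f => MonoidHom.map_cyclic f
  let s : M →* M := (σ.toMonoidHom.comp M.subtype).codRestrict M fun x => hM x x.2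
  have hs : ∀ m, ((s m : M) : G) = σ m := fun m => rfl
  have hsinj : Function.Injective s := fun a b h =>
    Subtype.ext (σ.injective (congrArg Subtype.val h))
  have key : ∀ (x : G) (m : M), MulAut.conjNormal (σ x) m = MulAut.conjNormal x m := by
    intro x m
    obtain ⟨m, rfl⟩ := Finite.surjective_of_injective hsinj m
    obtain ⟨k, hk⟩ := hpow (MulAut.conjNormal x : MulAut M).toMonoidHom
    have hk' : ∀ m, MulAut.conjNormal x m = m ^ k := hk
    have h1 : MulAut.conjNormal (σ x) (s m) = s (MulAut.conjNormal x m) :=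
      Subtype.ext (by simp [hs])
    rw [h1, hk', hk', map_zpow]
  intro m hm
  rw [Subgroup.mem_center_iff]
  intro g
  obtain ⟨x, rfl⟩ := hσ.commutatorMap_surjective g
  have h2 := congrArg Subtype.val (key x⁻¹ ⟨m, hm⟩)
  simp only [map_inv σ, MulAut.conjNormal_apply, inv_inv] at h2
  rw [MonoidHom.commutatorMap_apply, div_eq_mul_inv]
  calc x * (σ x)⁻¹ * m = x * ((σ x)⁻¹ * m * σ x) * (σ x)⁻¹ := by group
    _ = m * (x * (σ x)⁻¹) := by rw [h2]; group

theorem mul_pow_of_mul_eq_mul_mul_central {G : Type*} [Group G] {x y c : G}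
    (hc : c ∈ Subgroup.center G) (h : y * x = x * y * c) (n : ℕ) :
    y ^ n * x = x * y ^ n * c ^ n ∧ (x * y) ^ n = x ^ n * y ^ n * c ^ (n.choose 2) := by
  have hcc : ∀ (k : ℕ) (g : G), g * c ^ k = c ^ k * g :=
    fun k g => Subgroup.mem_center_iff.mp (pow_mem hc k) g
  induction n with
  | zero => simp
  | succ n ih =>
    obtain ⟨h1, h2⟩ := ih
    refine ⟨?_, ?_⟩
    · calc y ^ (n + 1) * x = y ^ n * (y * x) := by rw [pow_succ, mul_assoc]
        _ = y ^ n * x * (y * c) := by rw [h]; group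
        _ = x * y ^ n * (c ^ n * y) * c := by rw [h1]; group
        _ = x * y ^ (n + 1) * c ^ (n + 1) := by
          rw [← hcc, pow_succ, pow_succ]; group
    · calc (x * y) ^ (n + 1) = x ^ n * y ^ n * (c ^ n.choose 2 * (x * y)) := by
            rw [pow_succ, h2]; group
        _ = x ^ n * (y ^ n * x) * y * c ^ n.choose 2 := by rw [← hcc]; group
        _ = x ^ (n + 1) * y ^ n * (c ^ n * y) * c ^ n.choose 2 := by rw [h1, pow_succ]; group
        _ = x ^ (n + 1) * y ^ (n + 1) * c ^ ((n + 1).choose 2) := by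
          have hch : (n + 1).choose 2 = n + n.choose 2 := by
            rw [Nat.choose_succ_succ' n 1, Nat.choose_one_right]
          rw [← hcc, hch, pow_add, pow_succ y]; group

/-- The central elements with trivial `q`-th power. -/
def Subgroup.torsionCenter (G : Type*) [Group G] (q : ℕ) : Subgroup G where
  carrier := {x | x ∈ center G ∧ x ^ q = 1}
  one_mem' := ⟨one_mem _, one_pow q⟩
  mul_mem' := fun {x y} hx hy => ⟨mul_mem hx.1 hy.1, by
    rw [Commute.mul_pow (mem_center_iff.mp hy.1 x), hx.2, hy.2, mul_one]⟩
  inv_mem' := fun {x} hx => ⟨inv_mem hx.1, by rw [inv_pow, hx.2, inv_one]⟩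

/-- The elements whose image in `G ⧸ Z(G)` is central with trivial `q`-th power. -/
def Subgroup.torsionUpperCenter (G : Type*) [Group G] (q : ℕ) : Subgroup G :=
  (torsionCenter (G ⧸ center G) q).comap (QuotientGroup.mk' (center G))

namespace Subgroup

variable {G : Type*} [Group G] {q : ℕ}

theorem mem_torsionUpperCenter_iff_mk {x : G} : x ∈ torsionUpperCenter G q ↔
    (x : G ⧸ center G) ∈ center (G ⧸ center G) ∧ (x : G ⧸ center G) ^ q = 1 :=
  Iff.rfl

theorem mem_torsionUpperCenter {x : G} : x ∈ torsionUpperCenter G q ↔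
    (∀ w, ∃ c ∈ center G, w * x = x * w * c) ∧ x ^ q ∈ center G := by
  rw [mem_torsionUpperCenter_iff_mk, ← QuotientGroup.mk_pow, QuotientGroup.eq_one_iff]
  refine and_congr_left fun _ => ?_
  rw [mem_center_iff]
  constructor
  · intro h w
    have h' : ((x * w : G) : G ⧸ center G) = ((w * x : G) : G ⧸ center G) := (h w).symm
    exact ⟨_, QuotientGroup.eq.mp h', by group⟩
  · intro h w
    obtain ⟨w, rfl⟩ := QuotientGroup.mk_surjective w
    obtain ⟨c, hc, h⟩ := h w
    rw [← QuotientGroup.mk_mul, ← QuotientGroup.mk_mul, h, eq_comm, QuotientGroup.eq,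
      inv_mul_cancel_left]
    exact hc

theorem map_mem_center (σ : G ≃* G) {x : G} (hx : x ∈ center G) : σ x ∈ center G := by
  rw [mem_center_iff] at hx ⊢
  intro g
  obtain ⟨g, rfl⟩ := σ.surjective g
  rw [← map_mul, ← map_mul, hx]

theorem map_mem_torsionUpperCenter (σ : G ≃* G) {x : G} (hx : x ∈ torsionUpperCenter G q) :
    σ x ∈ torsionUpperCenter G q := by
  rw [mem_torsionUpperCenter] at hx ⊢
  refine ⟨fun w => ?_, by rw [← map_pow]; exact map_mem_center σ hx.2⟩
  obtain ⟨w, rfl⟩ := σ.surjective w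
  obtain ⟨c, hc, h⟩ := hx.1 w
  exact ⟨σ c, map_mem_center σ hc, by rw [← map_mul, h, map_mul, map_mul]⟩

instance normal_torsionUpperCenter : (torsionUpperCenter G q).Normal :=
  ⟨fun _ hx g => map_mem_torsionUpperCenter (MulAut.conj g) hx⟩

theorem mul_pow_of_mem_torsionUpperCenter (hq : q.Prime) (hq2 : q ≠ 2) {x y : G}
    (hx : x ∈ torsionUpperCenter G q) (hy : y ∈ torsionUpperCenter G q) :
    (x * y) ^ q = x ^ q * y ^ q := by
  rw [mem_torsionUpperCenter] at hx hy
  obtain ⟨c, hc, h⟩ := hx.1 y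
  obtain ⟨h1, h2⟩ := mul_pow_of_mul_eq_mul_mul_central hc h q
  have hcq : c ^ q = 1 := by
    rw [← mem_center_iff.mp hy.2 x] at h1
    exact left_eq_mul.mp h1
  -- `q` odd is what makes `q` divide `q.choose 2`
  obtain ⟨k, hk⟩ := hq.dvd_choose_self two_ne_zero (lt_of_le_of_ne hq.two_le hq2.symm)
  rw [h2, hk, pow_mul, hcq, one_pow, mul_one]

end Subgroup

theorem IsPGroup.exists_mem_center_pow_eq_one {G : Type*} [Group G] [Finite G] [Nontrivial G]
    {q : ℕ} (hq : q.Prime) (hG : IsPGroup q G) : ∃ z ∈ Subgroup.center G, z ^ q = 1 ∧ z ≠ 1 := by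
  have := Fact.mk hq
  have := hG.center_nontrivial
  have hd : q ∣ Nat.card (Subgroup.center G) := by
    obtain ⟨n, hn, h⟩ := (IsPGroup.nontrivial_iff_card (hG.to_subgroup _)).mp this
    exact h ▸ dvd_pow_self q hn.ne'
  obtain ⟨z, hz⟩ := exists_prime_orderOf_dvd_card' q hd
  refine ⟨z, z.2, ?_, fun h => ?_⟩
  · have h := pow_orderOf_eq_one z
    rw [hz] at h
    exact congrArg Subtype.val h
  · have h1 : z = 1 := Subtype.ext h
    rw [h1, orderOf_one] at hz
    exact hq.one_lt.ne hz

/-- The subgroup `C = torsionUpperCenter G q` is the crucial one. For odd `q` the map `x ↦ x ^ q` is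
a homomorphism from `C` to the cyclic group `Z(G)` with central kernel, so `C` is abelian, hence
cyclic, hence central; but if `Z(G) ≠ G` then `C` contains non-central elements. For `q = 2` the
group has at most one involution, which would be fixed. -/
theorem MonoidHom.FixedPointFree.isCyclic_of_isPGroup {Q : Type*} [Group Q] [Finite Q] {q : ℕ}
    (hq : q.Prime) (hQ : IsPGroup q Q) (hE : ElementaryAbelianCyclic Q) {σ : Q ≃* Q}
    (hσ : MonoidHom.FixedPointFree σ) : IsCyclic Q := by
  rcases subsingleton_or_nontrivial Q with _ | _
  · infer_instance
  obtain ⟨z, hz, hzq, hz1⟩ := hQ.exists_mem_center_pow_eq_one hq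
  have htors : ∀ x : Q, x ^ q = 1 → x ∈ Subgroup.zpowers z := fun x hx =>
    hE q hq x z (Subgroup.mem_center_iff.mp hz x) hx hzq hz1
  have hzle : Subgroup.zpowers z ≤ Subgroup.center Q := by
    rwa [Subgroup.zpowers_le]
  have hq2 : q ≠ 2 := by
    rintro rfl
    obtain ⟨k, hk⟩ := htors (σ z) (by rw [← map_pow, hzq, map_one])
    have hk : z ^ k = σ z := hk
    rcases Int.even_or_odd' k with ⟨m, rfl | rfl⟩
    · rw [zpow_mul, zpow_ofNat, hzq, one_zpow] at hk
      exact hz1 ((map_eq_one_iff σ σ.injective).mp hk.symm)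
    · rw [zpow_add, zpow_mul, zpow_ofNat, hzq, one_zpow, one_mul, zpow_one] at hk
      exact hz1 (hσ z hk.symm)
  let C := Subgroup.torsionUpperCenter Q q
  have : IsCyclic (Subgroup.center Q) := (hE.subgroup _).isCyclic_of_comm fun a b =>
    Subtype.ext (Subgroup.mem_center_iff.mp b.2 a)
  let f : C →* Subgroup.center Q :=
    { toFun := fun x => ⟨(x : Q) ^ q, (Subgroup.mem_torsionUpperCenter.mp x.2).2⟩
      map_one' := Subtype.ext (one_pow q)
      map_mul' := fun x y => Subtype.ext
        (Subgroup.mul_pow_of_mem_torsionUpperCenter hq hq2 x.2 y.2) }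
  have hf : f.ker ≤ Subgroup.center C := fun x hx => Subgroup.mem_center_iff.mpr fun y =>
    Subtype.ext (Subgroup.mem_center_iff.mp
      (hzle (htors x (congrArg Subtype.val (show f x = 1 from hx)))) y)
  have hCcomm : ∀ a b : C, a * b = b * a :=
    (f.isMulCommutative_of_isCyclic_of_ker_le_center hf).is_comm.comm
  have : IsCyclic C := (hE.subgroup C).isCyclic_of_comm hCcomm
  have hC : C ≤ Subgroup.center Q :=
    hσ.le_center_of_isCyclic C fun x hx => Subgroup.map_mem_torsionUpperCenter σ hx
  have htop : Subgroup.center Q = ⊤ := by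
    by_contra hne
    have : Nontrivial (Q ⧸ Subgroup.center Q) := QuotientGroup.nontrivial_iff.mpr hne
    obtain ⟨w, hw, hwq, hw1⟩ :=
      (hQ.to_quotient (Subgroup.center Q)).exists_mem_center_pow_eq_one hq
    obtain ⟨w, rfl⟩ := QuotientGroup.mk_surjective w
    exact hw1 ((QuotientGroup.eq_one_iff w).mpr
      (hC (Subgroup.mem_torsionUpperCenter_iff_mk.mpr ⟨hw, hwq⟩)))
  exact hE.isCyclic_of_comm fun a b =>
    Subgroup.mem_center_iff.mp (htop ▸ Subgroup.mem_top b) a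

open scoped Pointwise in
theorem MonoidHom.FixedPointFree.exists_sylow_map_mem {G : Type*} [Group G] [Finite G] (q : ℕ)
    [Fact q.Prime] {σ : G ≃* G} (hσ : MonoidHom.FixedPointFree σ) :
    ∃ P : Sylow q G, ∀ x ∈ P, σ x ∈ P := by
  obtain ⟨P⟩ : Nonempty (Sylow q G) := inferInstance
  let s : MulAut G := σ
  obtain ⟨g, hg⟩ := MulAction.exists_smul_eq G P (s • P)
  -- if `σ(P) = g P g⁻¹`, then `x P x⁻¹` is `σ`-invariant as soon as `σ x * g = x`
  obtain ⟨y, hy⟩ := hσ.commutatorMap_surjective g⁻¹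
  have hyg : σ y⁻¹ * g = y⁻¹ := by
    rw [MonoidHom.commutatorMap_apply] at hy
    rw [← inv_inv g, ← hy, map_inv, div_eq_mul_inv]
    group
  have hinv : s • (y⁻¹ • P) = y⁻¹ • P := by
    have hs : s * MulAut.conj y⁻¹ = MulAut.conj (σ y⁻¹) * s := by
      ext x
      simp [s]
    calc s • (y⁻¹ • P) = (s * MulAut.conj y⁻¹) • P := by rw [Sylow.smul_def, mul_smul]
      _ = (σ y⁻¹ * g) • P := by rw [hs, mul_smul, mul_smul, hg, ← Sylow.smul_def]
      _ = y⁻¹ • P := by rw [hyg]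
  refine ⟨y⁻¹ • P, fun x hx => ?_⟩
  have h : σ x ∈ s • ((y⁻¹ • P : Sylow q G) : Subgroup G) :=
    Subgroup.smul_mem_pointwise_smul x s _ hx
  rw [← Sylow.pointwise_smul_def, hinv] at h
  exact h

/-- A finite group with a fixed-point-free automorphism whose elementary abelian subgroups are
cyclic is cyclic: its Sylow subgroups are cyclic, so its commutator subgroup is cyclic, hence
central. -/
theorem MonoidHom.FixedPointFree.isCyclic_of_elementaryAbelianCyclic {G : Type*} [Group G]
    [Finite G] (hE : ElementaryAbelianCyclic G) {σ : G ≃* G} (hσ : MonoidHom.FixedPointFree σ) :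
    IsCyclic G := by
  have : IsZGroup G := by
    refine ⟨fun q hq P => ?_⟩
    have := Fact.mk hq
    obtain ⟨R, hR⟩ := hσ.exists_sylow_map_mem q
    let t : R →* R :=
      (σ.toMonoidHom.comp R.toSubgroup.subtype).codRestrict R.toSubgroup fun x => hR x x.2
    have hinj : Function.Injective t := fun a b h =>
      Subtype.ext (σ.injective (congrArg Subtype.val h))
    let τ : R ≃* R := MulEquiv.ofBijective t ⟨hinj, Finite.surjective_of_injective hinj⟩
    have hτ : MonoidHom.FixedPointFree τ := fun x hx =>
      Subtype.ext (hσ x (congrArg Subtype.val hx))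
    have : IsCyclic R := hτ.isCyclic_of_isPGroup hq R.isPGroup' (hE.subgroup _)
    exact isCyclic_of_surjective _ (R.equiv P).surjective
  have hcyc : IsCyclic (commutator G) := IsZGroup.isCyclic_commutator G
  have hle : commutator G ≤ Subgroup.center G := hσ.le_center_of_isCyclic _ fun x hx =>
    (Subgroup.characteristic_iff_map_le.mp inferInstance σ) (Subgroup.mem_map_of_mem _ hx)
  have : Group.IsNilpotent G := by
    refine Group.of_quotient_center_nilpotent ?_
    have hcomm : ∀ a b : G ⧸ Subgroup.center G, a * b = b * a := by
      intro a b
      obtain ⟨a, rfl⟩ := QuotientGroup.mk_surjective a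
      obtain ⟨b, rfl⟩ := QuotientGroup.mk_surjective b
      rw [← QuotientGroup.mk_mul, ← QuotientGroup.mk_mul, QuotientGroup.eq]
      have h := hle (Subgroup.commutator_mem_commutator (Subgroup.mem_top b⁻¹)
        (Subgroup.mem_top a⁻¹))
      rw [commutatorElement_def, inv_inv, inv_inv] at h
      rwa [mul_inv_rev, ← mul_assoc]
    let _ : CommGroup (G ⧸ Subgroup.center G) :=
      { (inferInstance : Group (G ⧸ Subgroup.center G)) with mul_comm := hcomm }
    infer_instance
  infer_instance

open Finset in
/-- If commuting `x` and `z` of order `q` acted fixed-point-freely on `V` without generating a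
cyclic group, the product of `(x * z ^ i) ^ j • v` over all `i, j < q` would be trivial, as each
factor with `i` fixed is a norm. Taking the product over `i` first, only `j = 0` contributes, and
gives `v ^ q`. -/
theorem pow_eq_one_of_fixedPointFree_action {A V : Type*} [Group A] [CommGroup V]
    (φ : A →* MulAut V) (hφ : ∀ a : A, a ≠ 1 → ∀ v, φ a v = v → v = 1) {q : ℕ} (hq : q.Prime)
    {x z : A} (hc : Commute x z) (hx : x ^ q = 1) (hz : z ^ q = 1) (hz1 : z ≠ 1)
    (hxz : x ∉ Subgroup.zpowers z) (v : V) : v ^ q = 1 := by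
  have norm : ∀ a : A, a ≠ 1 → a ^ q = 1 → ∀ w : V, ∏ i ∈ range q, φ (a ^ i) w = 1 := by
    intro a ha haq w
    refine hφ a ha _ ?_
    rw [map_prod]
    have h : ∀ i, φ a (φ (a ^ i) w) = φ (a ^ (i + 1)) w := fun i => by
      rw [pow_succ', map_mul, MulAut.mul_apply]
    simp only [h]
    rw [← mul_right_cancel_iff (a := φ (a ^ 0) w), ← prod_range_succ' (fun i => φ (a ^ i) w),
      prod_range_succ, haq, pow_zero]
  have h1 : ∏ i ∈ range q, ∏ j ∈ range q, φ ((x * z ^ i) ^ j) v = 1 := by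
    refine prod_eq_one fun i _ => norm _ (fun h => hxz ?_) ?_ v
    · rw [eq_inv_of_mul_eq_one_left h]
      exact inv_mem (Subgroup.npow_mem_zpowers z i)
    · rw [(hc.pow_right i).mul_pow, hx, ← pow_mul, mul_comm, pow_mul, hz, one_pow, one_mul]
  rw [prod_comm, prod_eq_single 0] at h1
  · simpa using h1
  · intro j hj hj0
    have hzj : z ^ j ≠ 1 := fun h => hz1 (by
      have hco : Nat.gcd j q = 1 :=
        (Nat.coprime_of_lt_prime hj0 (mem_range.mp hj) hq).symm
      simpa [hco] using (pow_gcd_eq_one (a := z)).mpr ⟨h, hz⟩)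
    have h2 : ∀ i, φ ((x * z ^ i) ^ j) v = φ ((z ^ j) ^ i) (φ (x ^ j) v) := by
      intro i
      rw [(hc.pow_right i).mul_pow, ← MulAut.mul_apply, ← map_mul, ← pow_mul, ← pow_mul,
        mul_comm i, (hc.pow_pow _ _).eq]
    simp only [h2]
    exact norm _ hzj (by rw [← pow_mul, mul_comm, pow_mul, hz, one_pow]) _
  · exact fun h => absurd (mem_range.mpr hq.pos) h

/-! ### Frobenius groups -/

namespace IsFrobeniusWith

variable {X : Type*} [Group X] {A N : Subgroup X}

theorem eq_one_of_mem_of_mem (h : IsFrobeniusWith A N) {x : X} (hA : x ∈ A) (hN : x ∈ N) :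
    x = 1 :=
  ((h.2 x).mp hN).resolve_right fun H => H 1 (by simpa using hA)

theorem exists_conj_mem (h : IsFrobeniusWith A N) {x : X} (hx : x ∉ N) : ∃ g, g * x * g⁻¹ ∈ A := by
  by_contra! H
  exact hx ((h.2 x).mpr (Or.inr H))

theorem eq_one_of_mul_eq_mul (h : IsFrobeniusWith A N) {a n : X} (ha : a ∈ A) (ha1 : a ≠ 1)
    (hn : n ∈ N) (hc : n * a = a * n) : n = 1 := by
  by_contra hn1
  refine ha1 (h.1.2.2 n (fun hnA => hn1 (h.eq_one_of_mem_of_mem hnA hn)) a ha ?_)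
  rwa [hc, mul_inv_cancel_right]

/-- Conjugating by representatives of the cosets of `A` gives a bijection from
`X ⧸ A × (A \ {1})` to `X \ N`. -/
theorem card_mul_card [Finite X] (h : IsFrobeniusWith A N) :
    Nat.card N * Nat.card A = Nat.card X := by
  have hNA : ∀ g : X, ∀ a ∈ A, g * a * g⁻¹ ∈ N → a = 1 := by
    intro g a ha hN
    rcases (h.2 _).mp hN with h1 | h1
    · simpa using h1
    · exact absurd ha (by simpa [mul_assoc] using h1 g⁻¹)
  let f : (X ⧸ A) × {a : A // a ≠ 1} → {x : X // x ∉ N} := fun y =>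
    ⟨y.1.out * y.2.1 * y.1.out⁻¹, fun H =>
      y.2.2 (Subtype.ext (hNA _ _ y.2.1.2 H))⟩
  have hf : Function.Bijective f := by
    constructor
    · rintro ⟨c, a, ha⟩ ⟨d, b, hb⟩ hab
      have hab' : c.out * a * c.out⁻¹ = d.out * b * d.out⁻¹ := congrArg Subtype.val hab
      have hcd : c = d := by
        rw [← Quotient.out_eq' c, ← Quotient.out_eq' d]
        refine (QuotientGroup.eq.mpr ?_).symm
        by_contra hmem
        refine ha (Subtype.ext (h.1.2.2 _ hmem a a.2 ?_))
        have : d.out⁻¹ * c.out * a * (d.out⁻¹ * c.out)⁻¹ = b := by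
          calc _ = d.out⁻¹ * (c.out * a * c.out⁻¹) * d.out := by group
            _ = b := by rw [hab']; group
        rw [this]
        exact b.2
      subst hcd
      have : a = b := Subtype.ext (by simpa using hab')
      subst this
      rfl
    · rintro ⟨x, hx⟩
      obtain ⟨g, hg⟩ := h.exists_conj_mem hx
      obtain ⟨b, hb⟩ := QuotientGroup.mk_out_eq_mul A g⁻¹
      have hx1 : x ≠ 1 := fun h1 => hx (h1 ▸ N.one_mem)
      refine ⟨⟨(g⁻¹ : X), ⟨b⁻¹ * ⟨g * x * g⁻¹, hg⟩ * b, fun h1 => hx1 ?_⟩⟩, Subtype.ext ?_⟩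
      · have h2 := congrArg Subtype.val h1
        simp only [Subgroup.coe_mul, Subgroup.coe_inv, Subgroup.coe_one] at h2
        have : x = g⁻¹ * b * ((b : X)⁻¹ * (g * x * g⁻¹) * b) * (g⁻¹ * b)⁻¹ := by group
        rw [this, h2]
        group
      · simp only [f, hb, Subgroup.coe_mul, Subgroup.coe_inv]
        group
  have e1 := Nat.card_congr (Equiv.ofBijective f hf)
  have e2 : Nat.card {a : A // a ≠ 1} + 1 = Nat.card A := by
    have := Fintype.ofFinite A
    classical
    rw [Nat.card_eq_fintype_card, Nat.card_eq_fintype_card, Fintype.card_subtype_compl,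
      Fintype.card_subtype_eq]
    exact Nat.sub_add_cancel Fintype.card_pos
  have e3 : Nat.card {x : X // x ∉ N} + Nat.card N = Nat.card X := by
    have := Fintype.ofFinite X
    classical
    rw [Nat.card_eq_fintype_card, Nat.card_eq_fintype_card, Nat.card_eq_fintype_card,
      Fintype.card_subtype_compl]
    exact Nat.sub_add_cancel (Fintype.card_subtype_le _)
  have e4 : Nat.card (X ⧸ A) * Nat.card A = Nat.card X := A.index_mul_card
  rw [Nat.card_prod] at e1
  have : Nat.card N = Nat.card (X ⧸ A) := by
    rw [← e2, mul_add, mul_one] at e4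
    omega
  rw [this, e4]

theorem isComplement' [Finite X] (h : IsFrobeniusWith A N) : Subgroup.IsComplement' N A :=
  Subgroup.isComplement'_of_card_mul_and_disjoint h.card_mul_card
    (Subgroup.disjoint_def.mpr fun hN hA => h.eq_one_of_mem_of_mem hA hN)

theorem exists_mul_eq [Finite X] (h : IsFrobeniusWith A N) (x : X) :
    ∃ n ∈ N, ∃ a ∈ A, n * a = x := by
  obtain ⟨⟨n, a⟩, hna⟩ := h.isComplement'.2 x
  exact ⟨n, n.2, a, a.2, hna⟩

theorem nontrivial_kernel [Finite X] (h : IsFrobeniusWith A N) : Nontrivial N := by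
  rw [Subgroup.nontrivial_iff_ne_bot]
  rintro rfl
  have h1 := h.card_mul_card
  rw [Subgroup.card_bot, one_mul] at h1
  exact h.1.2.1 (Subgroup.eq_top_of_card_eq A h1)

/-- A nontrivial `p`-element `a ∈ A` and a nontrivial central element of the `p`-group `N⟨a⟩` would
commute with each other and with `N`. -/
theorem eq_one_of_pow_eq_one [Finite X] [N.Normal] (h : IsFrobeniusWith A N) {p : ℕ} (hp : p.Prime)
    (hN : IsPGroup p N) {a : X} (ha : a ∈ A) {k : ℕ} (hk : a ^ p ^ k = 1) : a = 1 := by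
  by_contra ha1
  have hz : IsPGroup p (Subgroup.zpowers a) := by
    have := Fact.mk hp
    refine IsPGroup.iff_card.mpr ?_
    rw [Nat.card_zpowers]
    obtain ⟨m, _, hm⟩ := (Nat.dvd_prime_pow hp).mp (orderOf_dvd_of_pow_eq_one hk)
    exact ⟨m, hm⟩
  have hP : IsPGroup p (N ⊔ Subgroup.zpowers a : Subgroup X) := hN.to_sup_of_normal_left hz
  have haP : a ∈ N ⊔ Subgroup.zpowers a :=
    (le_sup_right : _ ≤ N ⊔ Subgroup.zpowers a) (Subgroup.mem_zpowers a)
  have : Nontrivial (N ⊔ Subgroup.zpowers a : Subgroup X) :=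
    ⟨⟨⟨a, haP⟩, 1, fun H => ha1 (congrArg Subtype.val H)⟩⟩
  obtain ⟨z, hzc, -, hz1⟩ := hP.exists_mem_center_pow_eq_one hp
  have hcomm : ∀ y ∈ N ⊔ Subgroup.zpowers a, y * z = z * y := fun y hy =>
    congrArg Subtype.val (Subgroup.mem_center_iff.mp hzc ⟨y, hy⟩)
  have hzA : (z : X) ∈ A := by
    by_contra hzA
    refine ha1 (h.1.2.2 z hzA a ha ?_)
    rwa [← hcomm a haP, mul_inv_cancel_right]
  obtain ⟨n, hn⟩ := @exists_ne N h.nontrivial_kernel 1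
  exact hn (Subtype.ext (h.eq_one_of_mul_eq_mul hzA (fun H => hz1 (Subtype.ext H)) n.2
    (hcomm n ((le_sup_left : N ≤ _) n.2))))

theorem elementaryAbelianCyclic [Finite X] [N.Normal] (h : IsFrobeniusWith A N) {p : ℕ}
    (hp : p.Prime) (hN : IsPGroup p N) : ElementaryAbelianCyclic A := by
  intro q hq x z hc hx hz hz1
  by_contra hxz
  have := h.nontrivial_kernel
  obtain ⟨v, hv, hvp, hv1⟩ := hN.exists_mem_center_pow_eq_one hp
  let V : Subgroup X := (Subgroup.center N).map N.subtype
  have hVN : ∀ v : V, (v : X) ∈ N := fun v => Subgroup.map_subtype_le _ v.2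
  let _ : CommGroup V :=
    { (inferInstance : Group V) with
      mul_comm := by
        rintro ⟨_, a, ha, rfl⟩ ⟨_, b, hb, rfl⟩
        exact Subtype.ext (congrArg (N.subtype ·) (Subgroup.mem_center_iff.mp hb a)) }
  let φ : A →* MulAut V := MulAut.conjNormal.comp A.subtype
  have hφ : ∀ a : A, a ≠ 1 → ∀ v, φ a v = v → v = 1 := by
    intro a ha v hav
    have hav' : (a : X) * v * (a : X)⁻¹ = v := congrArg Subtype.val hav
    exact Subtype.ext (h.eq_one_of_mul_eq_mul a.2 (fun H => ha (Subtype.ext H)) (hVN v)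
      (mul_inv_eq_iff_eq_mul.mp hav').symm)
  have hvq := pow_eq_one_of_fixedPointFree_action φ hφ hq hc hx hz hz1 hxz ⟨v, v, hv, rfl⟩
  have hvq' : v ^ q = 1 := Subtype.ext (congrArg (fun w : V => (w : X)) hvq)
  have hqp : q ≠ p := by
    rintro rfl
    exact hz1 (Subtype.ext (h.eq_one_of_pow_eq_one hq hN (k := 1) z.2
      (by simpa using congrArg Subtype.val hz)))
  refine hv1 ?_
  have hco : Nat.gcd q p = 1 := (Nat.coprime_primes hq hp).mpr hqp
  simpa [hco] using (pow_gcd_eq_one (a := v)).mpr ⟨hvq', hvp⟩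

end IsFrobeniusWith

/-! ### Connected components of the cyclic graph -/

theorem cyclicGraph_reachable_of_mem {G : Type*} [Group G] (B : Subgroup G) [IsCyclic B]
    {x y : {x : G // x ≠ 1}} (hx : (x : G) ∈ B) (hy : (y : G) ∈ B) :
    (cyclicGraph G).Reachable x y := by
  by_cases hxy : x = y
  · rw [hxy]
  · have hle : Subgroup.closure {(x : G), (y : G)} ≤ B := by
      rw [Subgroup.closure_le]
      rintro _ (rfl | rfl)
      exacts [hx, hy]
    exact SimpleGraph.Adj.reachable ⟨hxy, Subgroup.isCyclic_of_le hle⟩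

/-- If each nontrivial cyclic subgroup meets exactly one member of a family `F` of nontrivial cyclic
subgroups nontrivially, then this member labels the connected component. -/
theorem card_connectedComponent_cyclicGraph {G : Type*} [Group G] (F : Set (Subgroup G))
    (hbot : ∀ B ∈ F, B ≠ ⊥) (hcyc : ∀ B ∈ F, IsCyclic B)
    (hF : ∀ x : G, x ≠ 1 → ∃! B, B ∈ F ∧ B ⊓ Subgroup.zpowers x ≠ ⊥) :
    Nat.card (cyclicGraph G).ConnectedComponent = F.ncard := by
  have hmem : ∀ B : F, ∃ y : {x : G // x ≠ 1}, (y : G) ∈ (B : Subgroup G) := fun B => by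
    obtain ⟨y, hy, hy1⟩ := (B : Subgroup G).bot_or_exists_ne_one.resolve_left (hbot B B.2)
    exact ⟨⟨y, hy1⟩, hy⟩
  choose e he using hmem
  have hadj : ∀ x y, (cyclicGraph G).Adj x y → ∀ B ∈ F, B ⊓ Subgroup.zpowers (x : G) ≠ ⊥ →
      B ⊓ Subgroup.zpowers (y : G) ≠ ⊥ := by
    intro x y hxy B hB hBx
    obtain ⟨z, hz⟩ := (Subgroup.isCyclic_iff_exists_zpowers_eq_top _).mp hxy.2
    have hxz : Subgroup.zpowers (x : G) ≤ Subgroup.zpowers z := by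
      rw [Subgroup.zpowers_le, hz]
      exact Subgroup.subset_closure (by simp)
    have hyz : Subgroup.zpowers (y : G) ≤ Subgroup.zpowers z := by
      rw [Subgroup.zpowers_le, hz]
      exact Subgroup.subset_closure (by simp)
    have hz1 : z ≠ 1 := by
      rintro rfl
      rw [Subgroup.zpowers_one_eq_bot, le_bot_iff, Subgroup.zpowers_eq_bot] at hxz
      exact x.2 hxz
    obtain ⟨C, ⟨hC, hCy⟩, -⟩ := hF y y.2
    have hBC : B = C := (hF z hz1).unique ⟨hB, ne_bot_of_le_ne_bot hBx (inf_le_inf_left B hxz)⟩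
      ⟨hC, ne_bot_of_le_ne_bot hCy (inf_le_inf_left C hyz)⟩
    rwa [hBC]
  have hreach : ∀ x y, (cyclicGraph G).Reachable x y →
      ∀ B ∈ F, B ⊓ Subgroup.zpowers (x : G) ≠ ⊥ → B ⊓ Subgroup.zpowers (y : G) ≠ ⊥ := by
    rintro x y ⟨w⟩ B hB
    induction w with
    | nil => exact id
    | cons h _ ih => exact fun hx => ih (hadj _ _ h B hB hx)
  have hne : ∀ {B : Subgroup G} {x y : G}, y ≠ 1 → y ∈ B → y ∈ Subgroup.zpowers x →
      B ⊓ Subgroup.zpowers x ≠ ⊥ := fun hy1 hyB hyx h =>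
    hy1 (Subgroup.mem_bot.mp (h ▸ Subgroup.mem_inf.mpr ⟨hyB, hyx⟩))
  have hbij : Function.Bijective fun B : F => (cyclicGraph G).connectedComponentMk (e B) := by
    constructor
    · intro B C hBC
      have h := hreach _ _ (SimpleGraph.ConnectedComponent.exact hBC) B B.2
        (hne (e B).2 (he B) (Subgroup.mem_zpowers _))
      exact Subtype.ext ((hF (e C) (e C).2).unique ⟨B.2, h⟩
        ⟨C.2, hne (e C).2 (he C) (Subgroup.mem_zpowers _)⟩)
    · intro c
      induction c using SimpleGraph.ConnectedComponent.ind with | _ x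
      obtain ⟨B, ⟨hB, hBx⟩, -⟩ := hF x x.2
      obtain ⟨y, hy, hy1⟩ := (Subgroup.bot_or_exists_ne_one _).resolve_left hBx
      have := hcyc B hB
      refine ⟨⟨B, hB⟩, SimpleGraph.ConnectedComponent.sound ?_⟩
      exact (cyclicGraph_reachable_of_mem B (y := ⟨y, hy1⟩) (he ⟨B, hB⟩) hy.1).trans
        (cyclicGraph_reachable_of_mem (Subgroup.zpowers (x : G)) hy.2 (Subgroup.mem_zpowers _))
  rw [← Nat.card_coe_set_eq]
  exact (Nat.card_congr (Equiv.ofBijective _ hbij)).symm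

theorem IsCyclic.subgroup_eq_of_card_eq {G : Type*} [Group G] [Finite G] [IsCyclic G]
    {P Q : Subgroup G} (h : Nat.card P = Nat.card Q) : P = Q := by
  let _ : CommGroup G := IsCyclic.commGroup
  have key : ∀ R : Subgroup G, R = (powMonoidHom (Nat.card R) : G →* G).ker := fun R => by
    refine Subgroup.eq_of_le_of_card_ge (fun x hx => ?_) ?_
    · exact congrArg Subtype.val (pow_card_eq_one' (x := (⟨x, hx⟩ : R)))
    · rw [IsCyclic.card_powMonoidHom_ker]
      exact Nat.le_of_dvd Nat.card_pos (Nat.gcd_dvd_right _ _)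
  rw [key P, h, ← key Q]

theorem Subgroup.eq_of_card_eq_of_le {G : Type*} [Group G] [Finite G] {P Q C : Subgroup G}
    [IsCyclic C] (hP : P ≤ C) (hQ : Q ≤ C) (h : Nat.card P = Nat.card Q) : P = Q := by
  have h1 : P.subgroupOf C = Q.subgroupOf C := IsCyclic.subgroup_eq_of_card_eq (by
    rw [Nat.card_congr (Subgroup.subgroupOfEquivOfLe hP).toEquiv, h,
      Nat.card_congr (Subgroup.subgroupOfEquivOfLe hQ).toEquiv])
  rw [← inf_eq_left.mpr hP, ← inf_eq_left.mpr hQ]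
  exact Subgroup.subgroupOf_inj.mp h1

theorem existsUnique_card_eq_prime_of_pow_eq_one {G : Type*} [Group G] [Finite G] {p : ℕ}
    (hp : p.Prime) {x : G} (hx1 : x ≠ 1) {n : ℕ} (hx : x ^ p ^ n = 1) :
    ∃! P : Subgroup G, Nat.card P = p ∧ P ⊓ Subgroup.zpowers x ≠ ⊥ := by
  have := Fact.mk hp
  have hle : ∀ P : Subgroup G, Nat.card P = p → P ⊓ Subgroup.zpowers x ≠ ⊥ →
      P ≤ Subgroup.zpowers x := by
    intro P hP hne
    have h1 : (P ⊓ Subgroup.zpowers x).subgroupOf P = ⊤ := by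
      have : Fact (Nat.card P).Prime := ⟨hP ▸ hp⟩
      refine (Subgroup.eq_bot_or_eq_top_of_prime_card _).resolve_left fun h => hne ?_
      rw [Subgroup.subgroupOf_eq_bot, disjoint_iff] at h
      rwa [inf_right_comm, inf_idem] at h
    exact le_inf_iff.mp (Subgroup.subgroupOf_eq_top.mp h1) |>.2
  have hdvd : p ∣ orderOf x := by
    obtain ⟨m, _, hm⟩ := (Nat.dvd_prime_pow hp).mp (orderOf_dvd_of_pow_eq_one hx)
    rw [hm]
    refine dvd_pow_self p ?_
    rintro rfl
    exact hx1 (orderOf_eq_one_iff.mp (by simpa using hm))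
  obtain ⟨k, hk⟩ := hdvd
  have hxk : orderOf (x ^ k) = p := by
    have h0 := orderOf_pos x
    rw [orderOf_pow, hk, Nat.gcd_mul_left_left, Nat.mul_div_cancel]
    exact Nat.pos_of_ne_zero fun h => by
      rw [hk, h, mul_zero] at h0
      exact h0.ne rfl
  refine ⟨Subgroup.zpowers (x ^ k), ⟨by rw [Nat.card_zpowers, hxk], fun h => ?_⟩, ?_⟩
  · rw [inf_eq_left.mpr (Subgroup.zpowers_le.mpr (Subgroup.npow_mem_zpowers x k)),
      Subgroup.zpowers_eq_bot] at h
    rw [h, orderOf_one] at hxk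
    exact hp.one_lt.ne hxk
  · rintro P ⟨hP, hne⟩
    exact Subgroup.eq_of_card_eq_of_le (hle P hP hne)
      (Subgroup.zpowers_le.mpr (Subgroup.npow_mem_zpowers x k)) (by rw [hP, Nat.card_zpowers, hxk])

/-! ### 2-Frobenius groups -/

section

variable {G : Type*} [Group G] {K L : Subgroup G} [K.Normal] [L.Normal]

/-- The complement `H ≅ L ⧸ K` has cyclic elementary abelian subgroups, as it acts
fixed-point-freely on the `p`-group `K`, and `L ⧸ K` has fixed-point-free automorphisms, induced by
the elements of a complement in `G ⧸ K`. -/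
theorem IsTwoFrobenius.isCyclic_complement [Finite G] (hG : IsTwoFrobenius K L) {p : ℕ}
    (hp : p.Prime) (hK : IsPGroup p K) {H : Subgroup L} (hH : IsFrobeniusWith H (K.subgroupOf L)) :
    IsCyclic H := by
  obtain ⟨D, hD⟩ := hG.upper
  have hK' : IsPGroup p (K.subgroupOf L) := hK.comap_subtype
  let N := L.map (QuotientGroup.mk' K)
  have : N.Normal := Subgroup.Normal.map inferInstance _ (QuotientGroup.mk'_surjective K)
  let f : H →* N := ((QuotientGroup.mk' K).comp (L.subtype.comp H.subtype)).codRestrict N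
    fun h => ⟨h.1, h.1.2, rfl⟩
  have hinj : Function.Injective f := by
    rw [injective_iff_map_eq_one]
    intro h hh
    have hK : (h : L) ∈ K.subgroupOf L :=
      (QuotientGroup.eq_one_iff ((h : L) : G)).mp (congrArg Subtype.val hh)
    exact Subtype.ext (hH.eq_one_of_mem_of_mem h.2 hK)
  have hsurj : Function.Surjective f := by
    rintro ⟨_, l, hl, rfl⟩
    obtain ⟨n, hn, a, ha, hna⟩ := hH.exists_mul_eq ⟨l, hl⟩
    refine ⟨⟨a, ha⟩, Subtype.ext ?_⟩
    have hl' : (n : G) * a = l := congrArg Subtype.val hna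
    have hn' : QuotientGroup.mk' K (n : G) = 1 := (QuotientGroup.eq_one_iff _).mpr hn
    change QuotientGroup.mk' K (a : G) = QuotientGroup.mk' K l
    rw [← hl', map_mul, hn', one_mul]
  let e : H ≃* N := MulEquiv.ofBijective f ⟨hinj, hsurj⟩
  have hE : ElementaryAbelianCyclic N :=
    (hH.elementaryAbelianCyclic hp hK').of_injective e.symm.toMonoidHom e.symm.injective
  obtain ⟨d, hd, hd1⟩ := D.bot_or_exists_ne_one.resolve_left hD.1.1
  let σ : N ≃* N := MulAut.conjNormal d
  have hσ : MonoidHom.FixedPointFree σ := by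
    intro n hn
    have hn' : d * n * d⁻¹ = n := congrArg Subtype.val hn
    exact Subtype.ext (hD.eq_one_of_mul_eq_mul hd hd1 n.2 (mul_inv_eq_iff_eq_mul.mp hn').symm)
  have := hσ.isCyclic_of_elementaryAbelianCyclic hE
  exact isCyclic_of_surjective _ e.symm.surjective

theorem exists_pow_mem_of_isPGroup_quotient {p : ℕ} (hGL : IsPGroup p (G ⧸ L))
    {D : Subgroup (G ⧸ K)} (hD : IsFrobeniusWith D (L.map (QuotientGroup.mk' K))) {x : G}
    (hx : (x : G ⧸ K) ∈ D) : ∃ n, x ^ p ^ n ∈ K := by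
  obtain ⟨n, hn⟩ := hGL x
  rw [← QuotientGroup.mk_pow, QuotientGroup.eq_one_iff] at hn
  refine ⟨n, (QuotientGroup.eq_one_iff _).mp (hD.eq_one_of_mem_of_mem ?_ ⟨_, hn, rfl⟩)⟩
  rw [QuotientGroup.mk_pow]
  exact pow_mem hx _

theorem exists_pow_eq_one_of_pow_mem {G : Type*} [Group G] {K : Subgroup G} {p : ℕ}
    (hK : IsPGroup p K) {x : G} {n : ℕ}
    (hx : x ^ p ^ n ∈ K) : ∃ m, x ^ p ^ m = 1 := by
  obtain ⟨m, hm⟩ := hK ⟨_, hx⟩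
  refine ⟨n + m, ?_⟩
  rw [pow_add, pow_mul]
  exact congrArg Subtype.val hm

theorem IsTwoFrobenius.exists_pow_eq_one_of_notMem (hG : IsTwoFrobenius K L) {p : ℕ}
    (hK : IsPGroup p K) (hGL : IsPGroup p (G ⧸ L)) {x : G} (hx : x ∉ L) :
    ∃ m, x ^ p ^ m = 1 := by
  obtain ⟨D, hD⟩ := hG.upper
  have hxN : (x : G ⧸ K) ∉ L.map (QuotientGroup.mk' K) := by
    rintro ⟨l, hl, hlx⟩
    have h : l⁻¹ * x ∈ L := hG.le (QuotientGroup.eq.mp hlx)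
    exact hx ((Subgroup.mul_mem_cancel_left _ (inv_mem hl)).mp h)
  obtain ⟨g, hg⟩ := hD.exists_conj_mem hxN
  obtain ⟨g, rfl⟩ := QuotientGroup.mk_surjective g
  obtain ⟨n, hn⟩ := exists_pow_mem_of_isPGroup_quotient hGL hD (x := g * x * g⁻¹) hg
  obtain ⟨m, hm⟩ := exists_pow_eq_one_of_pow_mem hK hn
  refine ⟨m, ?_⟩
  rwa [conj_pow, mul_inv_eq_one, mul_eq_left] at hm

theorem IsTwoFrobenius.isPGroup_iff [Finite G] (hG : IsTwoFrobenius K L) {p : ℕ} {D : Subgroup G}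
    (hKD : K ≤ D)
    (hD : IsFrobeniusWith (D.map (QuotientGroup.mk' K)) (L.map (QuotientGroup.mk' K))) :
    IsPGroup p D ↔ IsPGroup p K ∧ IsPGroup p (G ⧸ L) := by
  constructor
  · intro h
    refine ⟨h.to_le hKD, fun y => ?_⟩
    obtain ⟨x, rfl⟩ := QuotientGroup.mk_surjective y
    obtain ⟨_, ⟨l, hl, rfl⟩, _, ⟨d, hd, rfl⟩, hx⟩ := hD.exists_mul_eq (x : G ⧸ K)
    rw [← map_mul] at hx
    have hk : ((l * d : G) : G ⧸ L) = x := QuotientGroup.eq.mpr (hG.le (QuotientGroup.eq.mp hx))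
    obtain ⟨n, hn⟩ := h ⟨d, hd⟩
    refine ⟨n, ?_⟩
    rw [← hk, QuotientGroup.mk_mul, (QuotientGroup.eq_one_iff l).mpr hl, one_mul,
      ← QuotientGroup.mk_pow, show d ^ p ^ n = 1 from congrArg Subtype.val hn,
      QuotientGroup.mk_one]
  · rintro ⟨hK, hGL⟩ ⟨d, hd⟩
    obtain ⟨n, hn⟩ := exists_pow_mem_of_isPGroup_quotient hGL hD (x := d) ⟨d, hd, rfl⟩
    obtain ⟨m, hm⟩ := exists_pow_eq_one_of_pow_mem hK hn
    exact ⟨m, Subtype.ext hm⟩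

/-- A cyclic subgroup of `G` is either a `p`-group, and then meets only its own subgroup of order
`p`, or it lies in `L \ K` apart from the identity, and then meets a single conjugate of the
complement `H`. The conjugates of `H` in `L` are in bijection with `K`. -/
theorem IsTwoFrobenius.card_connectedComponent [Finite G] (hG : IsTwoFrobenius K L) {p : ℕ}
    (hp : p.Prime) (hK : IsPGroup p K) (hGL : IsPGroup p (G ⧸ L)) :
    Nat.card (cyclicGraph G).ConnectedComponent = Nat.card K + numSubgroupsOfOrder p G := by
  obtain ⟨H, hH⟩ := hG.lower
  have hHcyc : IsCyclic H := hG.isCyclic_complement hp hK hH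
  have hK' : IsPGroup p (K.subgroupOf L) := hK.comap_subtype
  let c : K → Subgroup G := fun k => (H.map L.subtype).map (MulAut.conj (k : G)).toMonoidHom
  have mem_c : ∀ k x, x ∈ c k ↔ ∃ a : L, a ∈ H ∧ (k : G) * a * (k : G)⁻¹ = x := by
    intro k x
    constructor
    · rintro ⟨_, ⟨a, ha, rfl⟩, rfl⟩
      exact ⟨a, ha, rfl⟩
    · rintro ⟨a, ha, rfl⟩
      exact ⟨_, ⟨a, ha, rfl⟩, rfl⟩
  have c_disjoint : ∀ {k l x}, x ≠ 1 → x ∈ c k → x ∈ c l → k = l := by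
    intro k l x hx1 hk hl
    obtain ⟨a, ha, hax⟩ := (mem_c k x).mp hk
    obtain ⟨b, hb, hbx⟩ := (mem_c l x).mp hl
    let g : L := ⟨(l : G)⁻¹ * k, hG.le (mul_mem (inv_mem l.2) k.2)⟩
    have hgK : g ∈ K.subgroupOf L := mul_mem (inv_mem l.2) k.2
    have hgH : g ∈ H := by
      by_contra hgH
      have hgab : g * a * g⁻¹ = b := Subtype.ext <| by
        calc (l : G)⁻¹ * k * a * ((l : G)⁻¹ * k)⁻¹ = (l : G)⁻¹ * (k * a * (k : G)⁻¹) * l := by group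
          _ = b := by rw [hax, ← hbx]; group
      have ha1 : a = 1 := hH.1.2.2 g hgH a ha (hgab ▸ hb)
      exact hx1 (by rw [← hax, ha1]; simp)
    have hg1 : (l : G)⁻¹ * k = 1 := congrArg Subtype.val (hH.eq_one_of_mem_of_mem hgH hgK)
    exact Subtype.ext (inv_mul_eq_one.mp hg1).symm
  have c_ne_bot : ∀ k, c k ≠ ⊥ := by
    intro k h
    obtain ⟨a, ha, ha1⟩ := H.bot_or_exists_ne_one.resolve_left hH.1.1
    have h1 : (k : G) * a * (k : G)⁻¹ = 1 :=
      Subgroup.mem_bot.mp (h ▸ (mem_c k _).mpr ⟨a, ha, rfl⟩)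
    exact ha1 (Subtype.ext (conj_eq_one_iff.mp h1))
  have c_inj : Function.Injective c := by
    intro k l hkl
    obtain ⟨x, hx, hx1⟩ := (c k).bot_or_exists_ne_one.resolve_left (c_ne_bot k)
    exact c_disjoint hx1 hx (hkl ▸ hx)
  have c_pow : ∀ {k x n}, x ∈ c k → x ^ p ^ n = 1 → x = 1 := by
    intro k x n hx hn
    obtain ⟨a, ha, rfl⟩ := (mem_c k x).mp hx
    rw [conj_pow, conj_eq_one_iff] at hn
    rw [hH.eq_one_of_pow_eq_one hp hK' ha (k := n) (Subtype.ext hn)]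
    simp
  have c_exists : ∀ x ∈ L, x ∉ K → ∃ k, x ∈ c k := by
    intro x hxL hxK
    obtain ⟨g, hg⟩ := hH.exists_conj_mem (x := ⟨x, hxL⟩) hxK
    obtain ⟨n, hn, a, ha, hna⟩ := hH.exists_mul_eq g⁻¹
    refine ⟨⟨n, hn⟩, (mem_c _ _).mpr ⟨_, H.mul_mem (H.mul_mem ha hg) (H.inv_mem ha), ?_⟩⟩
    have hg' : g = a⁻¹ * n⁻¹ := by rw [← mul_inv_rev, hna, inv_inv]
    rw [hg']
    simp only [Subgroup.coe_mul, Subgroup.coe_inv]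
    group
  have p_pow : ∀ {P : Subgroup G} {x : G}, Nat.card P = p → x ∈ P → x ^ p ^ 1 = 1 := by
    intro P x hP hx
    rw [pow_one, ← hP]
    exact congrArg Subtype.val (pow_card_eq_one' (x := (⟨x, hx⟩ : P)))
  have hdisj : Disjoint (Set.range c) {P : Subgroup G | Nat.card P = p} := by
    rw [Set.disjoint_left]
    rintro _ ⟨k, rfl⟩ hk
    obtain ⟨x, hx, hx1⟩ := (c k).bot_or_exists_ne_one.resolve_left (c_ne_bot k)
    exact hx1 (c_pow hx (p_pow hk hx))
  rw [card_connectedComponent_cyclicGraph (Set.range c ∪ {P : Subgroup G | Nat.card P = p}),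
    Set.ncard_union_eq hdisj, Set.ncard_range_of_injective c_inj]
  · rfl
  · rintro B (⟨k, rfl⟩ | hB)
    · exact c_ne_bot k
    · rintro rfl
      replace hB : Nat.card (⊥ : Subgroup G) = p := hB
      rw [Subgroup.card_bot] at hB
      exact hp.one_lt.ne hB
  · rintro B (⟨k, rfl⟩ | hB)
    · have : IsCyclic (H.map L.subtype) :=
        isCyclic_of_surjective _ (L.subtype.subgroupMap_surjective H)
      exact isCyclic_of_surjective _ (MonoidHom.subgroupMap_surjective _ _)
    · have := Fact.mk hp
      exact isCyclic_of_prime_card hB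
  · intro x hx1
    by_cases hx : ∃ n, x ^ p ^ n = 1
    · obtain ⟨n, hn⟩ := hx
      obtain ⟨P, ⟨hP, hPx⟩, huniq⟩ := existsUnique_card_eq_prime_of_pow_eq_one hp hx1 hn
      refine ⟨P, ⟨Or.inr hP, hPx⟩, ?_⟩
      rintro B ⟨⟨k, rfl⟩ | hB, hBx⟩
      · obtain ⟨y, ⟨hyc, i, rfl⟩, hy1⟩ := (Subgroup.bot_or_exists_ne_one _).resolve_left hBx
        refine absurd (c_pow (n := n) hyc ?_) hy1
        change (x ^ i) ^ p ^ n = 1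
        rw [← zpow_natCast, zpow_comm, zpow_natCast, hn, one_zpow]
      · exact huniq B ⟨hB, hBx⟩
    · have hxL : x ∈ L := by
        by_contra hxL
        exact hx (hG.exists_pow_eq_one_of_notMem hK hGL hxL)
      have hxK : x ∉ K := fun hxK => hx (exists_pow_eq_one_of_pow_mem (n := 0) hK (by simpa))
      obtain ⟨k, hk⟩ := c_exists x hxL hxK
      have hle : Subgroup.zpowers x ≤ c k := Subgroup.zpowers_le.mpr hk
      refine ⟨c k, ⟨Or.inl ⟨k, rfl⟩, ?_⟩, ?_⟩
      · rwa [inf_eq_right.mpr hle, ne_eq, Subgroup.zpowers_eq_bot]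
      · rintro B ⟨hB, hBx⟩
        obtain ⟨y, ⟨hyB, hyx⟩, hy1⟩ := (Subgroup.bot_or_exists_ne_one _).resolve_left hBx
        rcases hB with ⟨l, rfl⟩ | hB
        · rw [c_disjoint hy1 hyB (hle hyx)]
        · exact absurd (c_pow (hle hyx) (p_pow hB hyB)) hy1

end

theorem theoremB {G : Type*} [Group G] [Finite G] (K L : Subgroup G) [K.Normal] [L.Normal]
    (hG : IsTwoFrobenius K L) (p : ℕ) (hp : p.Prime) :
    (∀ D : Subgroup G, K ≤ D →
      IsFrobeniusWith (D.map (QuotientGroup.mk' K)) (L.map (QuotientGroup.mk' K)) →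
      (IsPGroup p D ↔ IsPGroup p K ∧ IsPGroup p (G ⧸ L))) ∧
    (IsPGroup p K → IsPGroup p (G ⧸ L) →
      Nat.card (cyclicGraph G).ConnectedComponent = Nat.card K + numSubgroupsOfOrder p G) :=
  ⟨fun _ hKD hD => hG.isPGroup_iff hKD hD, hG.card_connectedComponent hp⟩
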